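/- Let $q$, $a$, $b$ be complex numbers with $0<|q|<1$ and $a+b\neq 0$. Write $(x;q)_\infty=\prod_{i\ge 0}(1-xq^i)$, $(x;q)_n=\prod_{i=0}^{n-1}(1-xq^i)$ and $(x_1,\dots,x_r;q)_n=\prod_{j=1}^{r}(x_j;q)_n$ for $n\in\{0,1,2,\dots\}\cup\{\infty\}$, and put \[\theta(q,x)=\sum_{n=0}^{\infty}(-1)^nq^{\binom n2}x^n,\qquad \Omega(a,b)=\sum_{n=0}^{\infty}(-1)^nq^{\binom n2}b^n\,\theta(q,aq^n),\] \[P(a,b)=(q,a,b;q)_\infty\sum_{n=0}^{\infty}\frac{(ab/q^3;q)_{2n}}{(q,a,b,ab/q^3;q)_n}\,q^n .\] All these products and series converge (that for $P(a,b)$ when no denominator vanishes, i.e. when $a,b\notin\{q^{-k}:k\ge0\}$ and $ab\notin\{q^{3-k}:k\ge 0\}$), and, in that case, \[\frac{q^2}{1+q}\,\Omega(a/q,b/q)-\frac{ab(a+b-q-q^2)}{(1+q)(a+b)}\,\Omega(a,b)-\frac{a^2b^2}{q(a+b)}\,\Omega(aq,bq)-\frac{aq^2+bq^2-ab-abq}{(1+q)(a+b)}=\frac{(a-bq)(b-aq)}{(1+q)(a+b)}\,P(a,b).\]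 The same identity holds for all $a,b$ with $a+b\ne0$, without the restriction on denominators, if $P(a,b)$ is read with common factors cancelled, i.e. as the convergent series \[P(a,b)=\sum_{n=0}^{\infty}(q^{n+1},aq^n,bq^n;q)_\infty\,(abq^{n-3};q)_n\,q^n .\] -/

import Mathlib

noncomputable section

namespace PartialTheta

/-- The infinite `q`-shifted factorial `(x;q)_∞ = ∏_{i ≥ 0} (1 - x q^i)`. -/
def qPochInf (q x : ℂ) : ℂ := ∏' i : ℕ, (1 - x * q ^ i)

/-- The finite `q`-shifted factorial `(x;q)_n = ∏_{0 ≤ i < n} (1 - x q^i)`. -/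
def qPoch (q x : ℂ) (n : ℕ) : ℂ := ∏ i ∈ Finset.range n, (1 - x * q ^ i)

/-- The partial theta function `θ(q,x) = ∑_{n ≥ 0} (-1)^n q^{n(n-1)/2} x^n`. -/
def theta (q x : ℂ) : ℂ := ∑' n : ℕ, (-1) ^ n * q ^ n.choose 2 * x ^ n

/-- `Ω(a,b) = ∑_{n ≥ 0} (-1)^n q^{n(n-1)/2} b^n θ(q, a q^n)`. -/
def Omega (q a b : ℂ) : ℂ :=
  ∑' n : ℕ, (-1) ^ n * q ^ n.choose 2 * b ^ n * theta q (a * q ^ n)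

/-- The `n`-th term `(ab/q^3;q)_{2n} / (q,a,b,ab/q^3;q)_n q^n` of the series in `P(a,b)`. -/
def PTerm (q a b : ℂ) (n : ℕ) : ℂ :=
  qPoch q (a * b / q ^ 3) (2 * n) /
    (qPoch q q n * qPoch q a n * qPoch q b n * qPoch q (a * b / q ^ 3) n) * q ^ n

/-- `P(a,b) = (q,a,b;q)_∞ ∑_{n ≥ 0} (ab/q^3;q)_{2n} / (q,a,b,ab/q^3;q)_n q^n`, meaningful when no
denominator vanishes. -/
def P (q a b : ℂ) : ℂ :=
  qPochInf q q * qPochInf q a * qPochInf q b * ∑' n : ℕ, PTerm q a b n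

/-- The `n`-th term of `P(a,b)` after multiplying `(q,a,b;q)_∞` into the series and cancelling
common factors: `(x;q)_∞ / (x;q)_n = (x q^n;q)_∞` and `(y;q)_{2n} / (y;q)_n = (y q^n;q)_n`. -/
def PExtTerm (q a b : ℂ) (n : ℕ) : ℂ :=
  qPochInf q (q * q ^ n) * qPochInf q (a * q ^ n) * qPochInf q (b * q ^ n) *
    qPoch q (a * b / q ^ 3 * q ^ n) n * q ^ n

/-- The extension of `P(a,b)` to all complex `a`, `b`, with common factors cancelled. -/
def PExt (q a b : ℂ) : ℂ := ∑' n : ℕ, PExtTerm q a b n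

end PartialTheta

end

noncomputable section

namespace PartialTheta

open Filter Topology

/-! The cancelled series `PExt` is a combination of four values of `Omega`, and the identity then
follows from functional equations. With `c = ab/q^3`, expand every factor of the `n`-th term by
Euler's series and the finite `q`-binomial theorem. The resulting quadruple series converges
absolutely, and its sum over `n` is Euler's series for `1/(q^(m+1);q)_∞`, which leaves `(q;q)_m`
(`hasSum_PExt_triple`). Collecting the coefficient of `a^A b^B` leaves a finite alternating sum of
`q`-trinomial coefficients, evaluated by `trinomSum_inv` as `q^(AB)` times a polynomial in `q^(-A)`
and `q^(-B)`. Since `q^(AB)` merges the two theta coefficients into that of index `A + B`, each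
monomial gives an `Omega` with arguments `a` or `a/q`, `b` or `b/q` (`PExt_eq`). By
`theta_functional`, `Omega_functional` and `sub_mul_Omega`, all four values reduce to `Omega(a,b)`
and `Omega(aq,bq)`. The mixed ones do so only after multiplication by `a - bq` or `b - aq`, whence
the factor in front of `P`. -/

/-! ### Finite `q`-factorials and Gaussian binomials. -/

lemma one_sub_pow_ne_zero {q : ℂ} (hq1 : ‖q‖ < 1) (n : ℕ) : 1 - q * q ^ n ≠ 0 := by
  intro h
  have h1 : ‖q * q ^ n‖ = 1 := by rw [← sub_eq_zero.mp h, norm_one]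
  have h2 : ‖q * q ^ n‖ < 1 := by
    rw [← pow_succ', norm_pow]
    exact pow_lt_one₀ (norm_nonneg _) hq1 n.succ_ne_zero
  exact h2.ne h1

lemma qPoch_zero (q x : ℂ) : qPoch q x 0 = 1 := Finset.prod_range_zero _

lemma qPoch_succ (q x : ℂ) (n : ℕ) : qPoch q x (n + 1) = qPoch q x n * (1 - x * q ^ n) :=
  Finset.prod_range_succ _ _

lemma qPoch_add (q x : ℂ) (m n : ℕ) :
    qPoch q x (m + n) = qPoch q x m * qPoch q (x * q ^ m) n := by
  simp only [qPoch, Finset.prod_range_add, pow_add, mul_assoc]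

lemma qPoch_self_ne_zero {q : ℂ} (hq1 : ‖q‖ < 1) (n : ℕ) : qPoch q q n ≠ 0 :=
  Finset.prod_ne_zero_iff.mpr fun i _ => one_sub_pow_ne_zero hq1 i

/-- The Gaussian binomial coefficient, as a quotient of `q`-factorials. -/
def gaussBinom (q : ℂ) (n k : ℕ) : ℂ :=
  if k ≤ n then qPoch q q n / (qPoch q q k * qPoch q q (n - k)) else 0

lemma gaussBinom_add (q : ℂ) (i k : ℕ) :
    gaussBinom q (k + i) k = qPoch q q (k + i) / (qPoch q q k * qPoch q q i) := by
  simp [gaussBinom]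

lemma gaussBinom_zero {q : ℂ} (hq1 : ‖q‖ < 1) (n : ℕ) : gaussBinom q n 0 = 1 := by
  simp [gaussBinom, qPoch_zero, qPoch_self_ne_zero hq1]

lemma gaussBinom_of_lt (q : ℂ) {n k : ℕ} (h : n < k) : gaussBinom q n k = 0 := by
  simp [gaussBinom, h]

lemma gaussBinom_succ_succ {q : ℂ} (hq1 : ‖q‖ < 1) {n k : ℕ} (hk : k ≤ n) :
    gaussBinom q (n + 1) (k + 1) = gaussBinom q n (k + 1) + q ^ (n - k) * gaussBinom q n k := by
  obtain ⟨i, rfl⟩ := Nat.exists_eq_add_of_le hk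
  have h := qPoch_self_ne_zero hq1
  have h' := one_sub_pow_ne_zero hq1
  rw [show k + i + 1 = k + 1 + i by ring, gaussBinom_add, gaussBinom_add]
  rcases i with _ | i
  · rw [gaussBinom_of_lt q (by omega)]
    simp [h, qPoch_zero]
  · rw [show k + (i + 1) = k + 1 + i by ring, gaussBinom_add,
      show k + 1 + i - k = i + 1 by omega, show k + 1 + (i + 1) = k + 1 + i + 1 by ring,
      qPoch_succ q q (k + 1 + i), qPoch_succ q q k, qPoch_succ q q i]
    have := h k; have := h i; have := h' k; have := h' i; have := h (k + 1 + i)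
    field_simp
    ring

lemma pow_choose_succ_two (q : ℂ) (k : ℕ) : q ^ (k + 1).choose 2 = q ^ k.choose 2 * q ^ k := by
  rw [Nat.choose_succ_succ' k 1, Nat.choose_one_right, pow_add, mul_comm]

/-- The finite `q`-binomial theorem. -/
lemma qPoch_eq_sum {q : ℂ} (hq1 : ‖q‖ < 1) (x : ℂ) (n : ℕ) :
    qPoch q x n =
      ∑ k ∈ Finset.range (n + 1), (-1) ^ k * q ^ k.choose 2 * gaussBinom q n k * x ^ k := by
  induction n with
  | zero => simp [qPoch_zero, gaussBinom_zero hq1]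
  | succ n ih =>
    have key : ∀ k ∈ Finset.range (n + 1),
        (-1) ^ (k + 1) * q ^ (k + 1).choose 2 * gaussBinom q (n + 1) (k + 1) * x ^ (k + 1) =
        (-1) ^ (k + 1) * q ^ (k + 1).choose 2 * gaussBinom q n (k + 1) * x ^ (k + 1) -
        x * q ^ n * ((-1) ^ k * q ^ k.choose 2 * gaussBinom q n k * x ^ k) := by
      intro k hk
      have hk' : k ≤ n := by simpa [Nat.lt_succ_iff] using hk
      rw [gaussBinom_succ_succ hq1 hk', pow_choose_succ_two, ← Nat.add_sub_of_le hk',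
        Nat.add_sub_cancel_left]
      ring
    rw [Finset.sum_range_succ', Finset.sum_congr rfl key, Finset.sum_sub_distrib, ← Finset.mul_sum,
      ← ih, qPoch_succ]
    have h2 := Finset.sum_range_succ'
      (fun k => (-1) ^ k * q ^ k.choose 2 * gaussBinom q n k * x ^ k) (n + 1)
    rw [Finset.sum_range_succ, ← ih, gaussBinom_of_lt q (Nat.lt_succ_self n)] at h2
    simp only [gaussBinom_zero hq1] at h2 ⊢
    linear_combination h2

/-! ### `q`-trinomial coefficients and their alternating sums. -/

/-- The coefficient `(q;q)_{A+B-k} / ((q;q)_{A-k} (q;q)_{B-k} (q;q)_k)`. -/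
def gaussTrinom (q : ℂ) (A B k : ℕ) : ℂ :=
  if k ≤ A ∧ k ≤ B then
    qPoch q q (A + B - k) / (qPoch q q (A - k) * qPoch q q (B - k) * qPoch q q k) else 0

/-- Parametrizing by the differences `i`, `j` removes truncated subtraction; all nonzero
coefficients have this form. -/
lemma gaussTrinom_add (q : ℂ) (i j k : ℕ) :
    gaussTrinom q (k + i) (k + j) k =
      qPoch q q (k + i + j) / (qPoch q q i * qPoch q q j * qPoch q q k) := by
  rw [gaussTrinom, if_pos (by omega), show k + i + (k + j) - k = k + i + j by omega]
  simp

lemma gaussTrinom_of_not (q : ℂ) {A B k : ℕ} (h : ¬(k ≤ A ∧ k ≤ B)) :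
    gaussTrinom q A B k = 0 := if_neg h

lemma gaussTrinom_zero_left {q : ℂ} (hq1 : ‖q‖ < 1) (B : ℕ) : gaussTrinom q 0 B 0 = 1 := by
  simp [gaussTrinom, qPoch_zero, qPoch_self_ne_zero hq1]

lemma gaussTrinom_zero_right {q : ℂ} (hq1 : ‖q‖ < 1) (A : ℕ) : gaussTrinom q A 0 0 = 1 := by
  simp [gaussTrinom, qPoch_zero, qPoch_self_ne_zero hq1]

lemma gaussTrinom_succ_succ_zero {q : ℂ} (hq1 : ‖q‖ < 1) (A B : ℕ) :
    gaussTrinom q (A + 1) (B + 1) 0 =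
      gaussTrinom q A (B + 1) 0 + q ^ (A + 1) * gaussTrinom q (A + 1) B 0 := by
  have h := qPoch_self_ne_zero hq1
  have h' := one_sub_pow_ne_zero hq1
  simp only [gaussTrinom, zero_le, and_self, if_true, Nat.sub_zero, qPoch_zero]
  rw [show A + 1 + (B + 1) = A + B + 1 + 1 by ring, show A + (B + 1) = A + B + 1 by ring,
    show A + 1 + B = A + B + 1 by ring, qPoch_succ q q (A + B + 1), qPoch_succ q q A,
    qPoch_succ q q B]
  have := h A; have := h B; have := h' A; have := h' B
  field_simp
  ring

/-- Pascal's rule removing one of the first kind, then of the third, then of the second. -/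
lemma gaussTrinom_pascal {q : ℂ} (hq1 : ‖q‖ < 1) {A k : ℕ} (B : ℕ) (hk : k ≤ A) :
    gaussTrinom q (A + 1) (B + 1) (k + 1) =
      gaussTrinom q A (B + 1) (k + 1) + q ^ (A - k) * gaussTrinom q A B k +
        q ^ (A + 1) * gaussTrinom q (A + 1) B (k + 1) := by
  have h := qPoch_self_ne_zero hq1
  have h' := one_sub_pow_ne_zero hq1
  by_cases hB : k ≤ B
  · obtain ⟨i, rfl⟩ := Nat.exists_eq_add_of_le hk
    obtain ⟨j, rfl⟩ := Nat.exists_eq_add_of_le hB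
    have := h k; have := h' k; have := h i; have := h j
    rw [Nat.add_sub_cancel_left, gaussTrinom_add, show k + i + 1 = k + 1 + i by ring,
      show k + j + 1 = k + 1 + j by ring, gaussTrinom_add]
    rcases i with _ | i <;> rcases j with _ | j
    · rw [gaussTrinom_of_not q (by omega), gaussTrinom_of_not q (by omega)]
      simp [h, qPoch_zero]
    · rw [gaussTrinom_of_not q (by omega), show k + (j + 1) = k + 1 + j by ring, gaussTrinom_add]
      simp only [add_zero, qPoch_zero]
      rw [← add_assoc, qPoch_succ q q (k + 1 + j), qPoch_succ q q k, qPoch_succ q q j,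
        show k + (j + 1) = k + 1 + j by ring]
      have := h j; have := h' j
      field_simp
      ring
    · rw [show k + 0 = k by rfl, gaussTrinom_of_not q (A := k + 1 + (i + 1)) (by omega),
        show k + (i + 1) = k + 1 + i by ring,
        show k + 1 + 0 = k + 1 + 0 by rfl, gaussTrinom_add]
      simp only [add_zero, qPoch_zero]
      rw [← add_assoc, qPoch_succ q q (k + 1 + i), qPoch_succ q q k, qPoch_succ q q i]
      have := h i; have := h' i
      field_simp
      ring
    · rw [show k + (i + 1) = k + 1 + i by ring, show k + (j + 1) = k + 1 + j by ring,
        gaussTrinom_add, gaussTrinom_add]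
      rw [show k + 1 + (i + 1) + (j + 1) = k + 1 + i + j + 1 + 1 by ring,
        show k + 1 + (i + 1) + j = k + 1 + i + j + 1 by ring,
        show k + 1 + i + (j + 1) = k + 1 + i + j + 1 by ring,
        qPoch_succ q q (k + 1 + i + j + 1), qPoch_succ q q k, qPoch_succ q q i, qPoch_succ q q j]
      have := h i; have := h j; have := h' i; have := h' j
      field_simp
      ring
  · simp [gaussTrinom_of_not, hB, show ¬ k + 1 ≤ B by omega]

/-- Pascal's rule removing one of the third kind, then of the first, then of the second. -/
lemma gaussTrinom_pascal' {q : ℂ} (hq1 : ‖q‖ < 1) {A k : ℕ} (B : ℕ) (hk : k ≤ A) :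
    gaussTrinom q (A + 1) (B + 1) (k + 1) =
      gaussTrinom q A B k + q ^ (k + 1) * gaussTrinom q A (B + 1) (k + 1) +
        q ^ (A + 1) * gaussTrinom q (A + 1) B (k + 1) := by
  have h := qPoch_self_ne_zero hq1
  have h' := one_sub_pow_ne_zero hq1
  have h1 := gaussTrinom_pascal hq1 B hk
  -- Both sides are `(q;q)_{A+B-k} / ((q;q)_{A-k-1} (q;q)_{B-k} (q;q)_k)`, and both vanish when `k =
  -- A` or `k > B`. This exchanges the first and third kinds.
  have h2 : (1 - q ^ (k + 1)) * gaussTrinom q A (B + 1) (k + 1) =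
      (1 - q ^ (A - k)) * gaussTrinom q A B k := by
    by_cases hc : k + 1 ≤ A ∧ k ≤ B
    · obtain ⟨i, rfl⟩ := Nat.exists_eq_add_of_le hc.1
      obtain ⟨j, rfl⟩ := Nat.exists_eq_add_of_le hc.2
      rw [show k + j + 1 = k + 1 + j by ring, gaussTrinom_add,
        show k + 1 + i = k + (i + 1) by ring, gaussTrinom_add, Nat.add_sub_cancel_left,
        qPoch_succ q q k, qPoch_succ q q i]
      have := h i; have := h j; have := h k; have := h' i; have := h' k
      field_simp
      ring
    · rw [gaussTrinom_of_not q (by omega)]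
      by_cases hB : k ≤ B
      · rw [show A - k = 0 by omega]; simp
      · rw [gaussTrinom_of_not q (by omega)]; simp
  linear_combination h1 + h2

/-- An alternating sum of trinomial coefficients with weights `q^{k(k-1)/2} z^k`. -/
def trinomSum (q z : ℂ) (A B : ℕ) : ℂ :=
  ∑ k ∈ Finset.range (A + 1), (-1) ^ k * q ^ k.choose 2 * z ^ k * gaussTrinom q A B k

lemma trinomSum_zero_left {q : ℂ} (hq1 : ‖q‖ < 1) (z : ℂ) (B : ℕ) : trinomSum q z 0 B = 1 := by
  simp [trinomSum, gaussTrinom_zero_left hq1]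

lemma trinomSum_zero_right {q : ℂ} (hq1 : ‖q‖ < 1) (z : ℂ) (A : ℕ) : trinomSum q z A 0 = 1 := by
  rw [trinomSum, Finset.sum_range_succ', Finset.sum_eq_zero, gaussTrinom_zero_right hq1]
  · simp
  · intro k _
    rw [gaussTrinom_of_not q (by omega), mul_zero]

lemma trinomSum_extend (q z : ℂ) (A B : ℕ) :
    trinomSum q z A B = ∑ k ∈ Finset.range (A + 1),
      (-1) ^ (k + 1) * q ^ (k + 1).choose 2 * z ^ (k + 1) * gaussTrinom q A B (k + 1) +
      gaussTrinom q A B 0 := by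
  have h2 := Finset.sum_range_succ'
    (fun k => (-1) ^ k * q ^ k.choose 2 * z ^ k * gaussTrinom q A B k) (A + 1)
  rw [Finset.sum_range_succ, gaussTrinom_of_not q (k := A + 1) (by omega)] at h2
  rw [trinomSum]
  simpa using h2

/-- In `gaussTrinom_pascal` the weight `q^(A-k)` meets the `q^k` from the shifted binomial exponent;
their product `q^A` is free of `k`. -/
lemma trinomSum_one_succ_succ {q : ℂ} (hq1 : ‖q‖ < 1) (A B : ℕ) :
    trinomSum q 1 (A + 1) (B + 1) = trinomSum q 1 A (B + 1) - q ^ A * trinomSum q 1 A B +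
      q ^ (A + 1) * trinomSum q 1 (A + 1) B := by
  have h1 : trinomSum q 1 (A + 1) B = ∑ k ∈ Finset.range (A + 1),
      (-1) ^ (k + 1) * q ^ (k + 1).choose 2 * 1 ^ (k + 1) * gaussTrinom q (A + 1) B (k + 1) +
      gaussTrinom q (A + 1) B 0 := by
    rw [trinomSum, Finset.sum_range_succ']; simp
  rw [trinomSum_extend q 1 A (B + 1), h1, trinomSum, trinomSum, Finset.sum_range_succ',
    gaussTrinom_succ_succ_zero hq1]
  have key : ∀ k ∈ Finset.range (A + 1),
      (-1) ^ (k + 1) * q ^ (k + 1).choose 2 * 1 ^ (k + 1) *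
        gaussTrinom q (A + 1) (B + 1) (k + 1) =
      (-1) ^ (k + 1) * q ^ (k + 1).choose 2 * 1 ^ (k + 1) * gaussTrinom q A (B + 1) (k + 1) -
      q ^ A * ((-1) ^ k * q ^ k.choose 2 * 1 ^ k * gaussTrinom q A B k) + q ^ (A + 1) *
      ((-1) ^ (k + 1) * q ^ (k + 1).choose 2 * 1 ^ (k + 1) * gaussTrinom q (A + 1) B (k + 1)) := by
    intro k hk
    have hk' : k ≤ A := by simpa [Nat.lt_succ_iff] using hk
    rw [gaussTrinom_pascal hq1 B hk', pow_choose_succ_two]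
    obtain ⟨i, rfl⟩ := Nat.exists_eq_add_of_le hk'
    rw [Nat.add_sub_cancel_left]
    ring
  rw [Finset.sum_congr rfl key, Finset.sum_add_distrib, Finset.sum_sub_distrib, ← Finset.mul_sum,
    ← Finset.mul_sum]
  simp
  ring

/-- A form of the `q`-Chu–Vandermonde summation. -/
lemma trinomSum_one {q : ℂ} (hq1 : ‖q‖ < 1) (A B : ℕ) : trinomSum q 1 A B = q ^ (A * B) := by
  induction A generalizing B with
  | zero => simp [trinomSum_zero_left hq1]
  | succ A ihA =>
    induction B with
    | zero => simp [trinomSum_zero_right hq1]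
    | succ B ihB =>
      rw [trinomSum_one_succ_succ hq1, ihA, ihA, ihB]
      ring

/-- In `gaussTrinom_pascal'` the weight `q^(k+1)` cancels `q⁻¹ ^ (k+1)`, so the terms with `A`
lowered become sums at `z = 1`, already known from `trinomSum_one`. -/
lemma trinomSum_inv_succ_succ {q : ℂ} (hq0 : q ≠ 0) (hq1 : ‖q‖ < 1) (A B : ℕ) :
    trinomSum q q⁻¹ (A + 1) (B + 1) = trinomSum q 1 A (B + 1) - q⁻¹ * trinomSum q 1 A B +
      q ^ (A + 1) * trinomSum q q⁻¹ (A + 1) B := by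
  have h1 : trinomSum q q⁻¹ (A + 1) B = ∑ k ∈ Finset.range (A + 1),
      (-1) ^ (k + 1) * q ^ (k + 1).choose 2 * q⁻¹ ^ (k + 1) * gaussTrinom q (A + 1) B (k + 1) +
      gaussTrinom q (A + 1) B 0 := by
    rw [trinomSum, Finset.sum_range_succ']; simp
  rw [trinomSum_extend q 1 A (B + 1), h1, trinomSum, trinomSum, Finset.sum_range_succ',
    gaussTrinom_succ_succ_zero hq1]
  have key : ∀ k ∈ Finset.range (A + 1),
      (-1) ^ (k + 1) * q ^ (k + 1).choose 2 * q⁻¹ ^ (k + 1) *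
        gaussTrinom q (A + 1) (B + 1) (k + 1) =
      (-1) ^ (k + 1) * q ^ (k + 1).choose 2 * 1 ^ (k + 1) * gaussTrinom q A (B + 1) (k + 1) -
      q⁻¹ * ((-1) ^ k * q ^ k.choose 2 * 1 ^ k * gaussTrinom q A B k) + q ^ (A + 1) *
      ((-1) ^ (k + 1) * q ^ (k + 1).choose 2 * q⁻¹ ^ (k + 1) *
        gaussTrinom q (A + 1) B (k + 1)) := by
    intro k hk
    have hk' : k ≤ A := by simpa [Nat.lt_succ_iff] using hk
    rw [gaussTrinom_pascal' hq1 B hk', pow_choose_succ_two, inv_pow]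
    field_simp
    ring
  rw [Finset.sum_congr rfl key, Finset.sum_add_distrib, Finset.sum_sub_distrib, ← Finset.mul_sum,
    ← Finset.mul_sum]
  simp
  ring

lemma trinomSum_inv {q : ℂ} (hq0 : q ≠ 0) (hq1 : ‖q‖ < 1) (A B : ℕ) :
    trinomSum q q⁻¹ A B =
      q ^ (A * B) * (1 + (1 - (q ^ A)⁻¹) * (1 - (q ^ B)⁻¹) / (q - 1)) := by
  have hq : q - 1 ≠ 0 := by
    rw [sub_ne_zero]; rintro rfl; simp at hq1
  rcases A with _ | A
  · simp [trinomSum_zero_left hq1]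
  induction B with
  | zero => simp [trinomSum_zero_right hq1]
  | succ B ihB =>
    rw [trinomSum_inv_succ_succ hq0 hq1, trinomSum_one hq1, trinomSum_one hq1, ihB,
      show (A + 1) * (B + 1) = A * B + A + B + 1 by ring,
      show (A + 1) * B = A * B + B by ring, show A * (B + 1) = A * B + A by ring]
    simp only [pow_add, pow_one]
    field_simp
    ring

/-! ### Infinite products. -/

lemma multipliable_one_sub {q : ℂ} (hq1 : ‖q‖ < 1) (x : ℂ) :
    Multipliable fun i : ℕ => 1 - x * q ^ i := by
  have h : Summable fun i : ℕ => ‖-(x * q ^ i)‖ := by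
    simp only [norm_neg, norm_mul, norm_pow]
    exact (summable_geometric_of_lt_one (norm_nonneg _) hq1).mul_left _
  simpa [sub_eq_add_neg] using multipliable_one_add_of_summable h

lemma tendsto_qPoch {q : ℂ} (hq1 : ‖q‖ < 1) (x : ℂ) :
    Tendsto (qPoch q x) atTop (𝓝 (qPochInf q x)) :=
  (multipliable_one_sub hq1 x).tendsto_prod_tprod_nat

lemma qPochInf_eq_mul {q : ℂ} (hq1 : ‖q‖ < 1) (x : ℂ) (n : ℕ) :
    qPochInf q x = qPoch q x n * qPochInf q (x * q ^ n) := by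
  refine tendsto_nhds_unique ((tendsto_add_atTop_iff_nat n).mpr (tendsto_qPoch hq1 x)) ?_
  simp only [add_comm _ n, qPoch_add]
  exact (tendsto_qPoch hq1 _).const_mul _

lemma qPochInf_ne_zero {q : ℂ} (hq1 : ‖q‖ < 1) {x : ℂ} (hx : ∀ k : ℕ, 1 - x * q ^ k ≠ 0) :
    qPochInf q x ≠ 0 := by
  have h : Summable fun i : ℕ => ‖-(x * q ^ i)‖ := by
    simp only [norm_neg, norm_mul, norm_pow]
    exact (summable_geometric_of_lt_one (norm_nonneg _) hq1).mul_left _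
  have := tprod_one_add_ne_zero_of_summable (f := fun i : ℕ => -(x * q ^ i))
    (fun i => by simpa [sub_eq_add_neg] using hx i) h
  simpa [qPochInf, sub_eq_add_neg] using this

lemma exists_norm_inv_qPoch_self_le {q : ℂ} (hq1 : ‖q‖ < 1) :
    ∃ K : ℝ, 0 ≤ K ∧ ∀ n, ‖(qPoch q q n)⁻¹‖ ≤ K := by
  have h := (tendsto_qPoch hq1 q).inv₀ (qPochInf_ne_zero hq1 (one_sub_pow_ne_zero hq1))
  obtain ⟨K, hK⟩ := (Metric.isBounded_range_of_tendsto _ h).exists_norm_le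
  exact ⟨K, (norm_nonneg _).trans (hK _ ⟨0, rfl⟩), fun n => hK _ ⟨n, rfl⟩⟩

/-! ### The partial theta function, `Omega`, and their functional equations. -/

/-- The coefficient `(-1)^n q^{n(n-1)/2}` of the partial theta function. -/
def thetaCoeff (q : ℂ) (n : ℕ) : ℂ := (-1) ^ n * q ^ n.choose 2

lemma thetaCoeff_zero (q : ℂ) : thetaCoeff q 0 = 1 := by simp [thetaCoeff]

lemma thetaCoeff_succ (q : ℂ) (n : ℕ) : thetaCoeff q (n + 1) = -(q ^ n * thetaCoeff q n) := by
  rw [thetaCoeff, thetaCoeff, pow_choose_succ_two]; ring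

/-- The exponent satisfies `C(m+n,2) = C(m,2) + C(n,2) + mn`. This makes the double series of
`Omega` symmetric. -/
lemma thetaCoeff_add (q : ℂ) (m n : ℕ) :
    thetaCoeff q (m + n) = thetaCoeff q m * thetaCoeff q n * q ^ (m * n) := by
  induction n with
  | zero => simp [thetaCoeff_zero]
  | succ n ih => rw [← add_assoc, thetaCoeff_succ, thetaCoeff_succ, ih]; ring

lemma summable_norm_thetaCoeff {q : ℂ} (hq1 : ‖q‖ < 1) (x : ℂ) :
    Summable fun n : ℕ => ‖thetaCoeff q n * x ^ n‖ := by
  refine summable_of_ratio_norm_eventually_le (r := 1 / 2) (by norm_num) ?_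
  have h : Tendsto (fun n : ℕ => ‖q ^ n * x‖) atTop (𝓝 0) := by
    simpa using ((tendsto_pow_atTop_nhds_zero_of_norm_lt_one hq1).mul_const x).norm
  filter_upwards [h.eventually_le_const (show (0 : ℝ) < 1 / 2 by norm_num)] with n hn
  rw [norm_norm, norm_norm, thetaCoeff_succ,
    show -(q ^ n * thetaCoeff q n) * x ^ (n + 1) = -((q ^ n * x) * (thetaCoeff q n * x ^ n)) by ring,
    norm_neg, norm_mul]
  gcongr

lemma summable_thetaCoeff {q : ℂ} (hq1 : ‖q‖ < 1) (x : ℂ) :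
    Summable fun n : ℕ => thetaCoeff q n * x ^ n := (summable_norm_thetaCoeff hq1 x).of_norm

lemma theta_eq (q x : ℂ) : theta q x = ∑' n : ℕ, thetaCoeff q n * x ^ n := rfl

lemma theta_functional {q : ℂ} (hq1 : ‖q‖ < 1) (x : ℂ) : theta q x = 1 - x * theta q (x * q) := by
  rw [theta_eq, (summable_thetaCoeff hq1 x).tsum_eq_zero_add, theta_eq, ← tsum_mul_left,
    sub_eq_add_neg, ← tsum_neg]
  simp only [thetaCoeff_zero, pow_zero, mul_one, thetaCoeff_succ]
  congr 1
  exact tsum_congr fun n => by ring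

/-- The general term of the double series for `Ω(a,b)`. -/
def omegaTerm (q a b : ℂ) (p : ℕ × ℕ) : ℂ := thetaCoeff q (p.1 + p.2) * a ^ p.1 * b ^ p.2

lemma summable_omegaTerm {q : ℂ} (hq1 : ‖q‖ < 1) (a b : ℂ) : Summable (omegaTerm q a b) := by
  refine Summable.of_norm_bounded ((summable_norm_thetaCoeff hq1 a).mul_of_nonneg
    (summable_norm_thetaCoeff hq1 b) (fun _ => norm_nonneg _) fun _ => norm_nonneg _) ?_
  rintro ⟨m, n⟩
  rw [omegaTerm, thetaCoeff_add, show thetaCoeff q m * thetaCoeff q n * q ^ (m * n) * a ^ m * b ^ n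
    = q ^ (m * n) * ((thetaCoeff q m * a ^ m) * (thetaCoeff q n * b ^ n)) by ring, norm_mul,
    norm_mul (thetaCoeff q m * a ^ m), norm_pow]
  exact mul_le_of_le_one_left (by positivity) (pow_le_one₀ (norm_nonneg _) hq1.le)

lemma hasSum_omegaTerm_left {q : ℂ} (hq1 : ‖q‖ < 1) (a b : ℂ) (n : ℕ) :
    HasSum (fun m => omegaTerm q a b (m, n)) (thetaCoeff q n * b ^ n * theta q (a * q ^ n)) := by
  have h : (fun m => omegaTerm q a b (m, n)) =
      fun m => thetaCoeff q n * b ^ n * (thetaCoeff q m * (a * q ^ n) ^ m) := by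
    funext m
    rw [omegaTerm, thetaCoeff_add]
    ring
  rw [h]
  exact (summable_thetaCoeff hq1 (a * q ^ n)).hasSum.mul_left _

lemma hasSum_omegaTerm_swap {q : ℂ} (hq1 : ‖q‖ < 1) (a b : ℂ) :
    HasSum (fun n => thetaCoeff q n * b ^ n * theta q (a * q ^ n)) (∑' p, omegaTerm q a b p) :=
  ((Equiv.prodComm ℕ ℕ).hasSum_iff.mpr (summable_omegaTerm hq1 a b).hasSum).prod_fiberwise
    (hasSum_omegaTerm_left hq1 a b)

lemma hasSum_omegaTerm {q : ℂ} (hq1 : ‖q‖ < 1) (a b : ℂ) :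
    HasSum (omegaTerm q a b) (Omega q a b) := by
  have h : Omega q a b = ∑' p, omegaTerm q a b p := (hasSum_omegaTerm_swap hq1 a b).tsum_eq
  rw [h]
  exact (summable_omegaTerm hq1 a b).hasSum

lemma summable_Omega {q : ℂ} (hq1 : ‖q‖ < 1) (a b : ℂ) :
    Summable fun n => thetaCoeff q n * b ^ n * theta q (a * q ^ n) :=
  (hasSum_omegaTerm_swap hq1 a b).summable

lemma Omega_symm {q : ℂ} (hq1 : ‖q‖ < 1) (a b : ℂ) : Omega q a b = Omega q b a := by
  refine (hasSum_omegaTerm hq1 a b).unique ?_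
  convert (Equiv.prodComm ℕ ℕ).hasSum_iff.mpr (hasSum_omegaTerm hq1 b a) using 1
  funext p
  simp only [omegaTerm, Function.comp, Equiv.prodComm_apply, Prod.fst_swap, Prod.snd_swap,
    add_comm p.2]
  ring

lemma Omega_functional {q : ℂ} (hq1 : ‖q‖ < 1) (a b : ℂ) :
    Omega q a b = theta q a - b * Omega q (a * q) (b * q) := by
  have h : Omega q a b = ∑' n, thetaCoeff q n * b ^ n * theta q (a * q ^ n) := rfl
  have h' : Omega q (a * q) (b * q) =
    ∑' n, thetaCoeff q n * (b * q) ^ n * theta q (a * q * q ^ n) := rfl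
  rw [h, (summable_Omega hq1 a b).tsum_eq_zero_add, h', ← tsum_mul_left,
    sub_eq_add_neg, ← tsum_neg]
  simp only [thetaCoeff_zero, pow_zero, mul_one, one_mul, thetaCoeff_succ]
  congr 1
  exact tsum_congr fun n => by rw [pow_succ' q n, ← mul_assoc]; ring

/-- Eliminate `Omega(aq,bq)` between `Omega_functional` and its image under exchanging `a` and `b`.
-/
lemma sub_mul_Omega {q : ℂ} (hq1 : ‖q‖ < 1) (a b : ℂ) :
    (a - b) * Omega q a b = a * theta q a - b * theta q b := by
  have h1 := Omega_functional hq1 a b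
  have h2 := Omega_functional hq1 b a
  rw [Omega_symm hq1 b a, Omega_symm hq1 (b * q)] at h2
  linear_combination a * h1 - b * h2

/-! ### Euler's two expansions. -/

/-- The general term of Euler's expansion of `(x;q)_∞`. -/
def eulerTerm (q x : ℂ) (n : ℕ) : ℂ := thetaCoeff q n * x ^ n / qPoch q q n

lemma summable_norm_eulerTerm {q : ℂ} (hq1 : ‖q‖ < 1) (x : ℂ) :
    Summable fun n => ‖eulerTerm q x n‖ := by
  obtain ⟨K, hK0, hK⟩ := exists_norm_inv_qPoch_self_le hq1
  refine Summable.of_nonneg_of_le (fun _ => norm_nonneg _) (fun n => ?_)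
    ((summable_norm_thetaCoeff hq1 x).mul_right K)
  rw [eulerTerm, div_eq_mul_inv, norm_mul]
  exact mul_le_mul_of_nonneg_left (hK n) (norm_nonneg _)

lemma eulerTerm_mul_pow (q x : ℂ) (n m : ℕ) :
    eulerTerm q (x * q ^ n) m = eulerTerm q x m * q ^ (n * m) := by
  rw [eulerTerm, eulerTerm, mul_pow, ← pow_mul]; ring

/-- Continuity at `0` of a power series along `x q^n`: this closes the iteration of the
`q`-difference equation in both Euler expansions. -/
lemma tendsto_tsum_mul_pow {q : ℂ} (hq1 : ‖q‖ < 1) {f : ℕ → ℂ} (hf : Summable fun n => ‖f n‖) :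
    Tendsto (fun n : ℕ => ∑' m, f m * q ^ (n * m)) atTop (𝓝 (f 0)) := by
  have h : f 0 = ∑' m, f m * (if m = 0 then 1 else 0) := by simp
  rw [h]
  refine tendsto_tsum_of_dominated_convergence hf (fun m => ?_) (.of_forall fun n m => ?_)
  · refine Tendsto.const_mul _ ?_
    rcases m with _ | m
    · simp
    · simp only [pow_mul, Nat.succ_ne_zero, if_false]
      simpa using (tendsto_pow_atTop_nhds_zero_of_norm_lt_one hq1).pow (m + 1)
  · rw [norm_mul, norm_pow]
    exact mul_le_of_le_one_right (norm_nonneg _) (pow_le_one₀ (norm_nonneg _) hq1.le)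

lemma hasSum_eulerTerm {q : ℂ} (hq1 : ‖q‖ < 1) (x : ℂ) :
    HasSum (eulerTerm q x) (qPochInf q x) := by
  have hs : ∀ y, Summable (eulerTerm q y) := fun y => (summable_norm_eulerTerm hq1 y).of_norm
  -- The factor `1 - q^(n+1)` produced by the difference cancels the last factor of `(q;q)_{n+1}`.
  have hstep : ∀ y, ∑' n, eulerTerm q y n = (1 - y) * ∑' n, eulerTerm q (y * q) n := by
    intro y
    have h1 : ∑' n, eulerTerm q y n - ∑' n, eulerTerm q (y * q) n =
        -(y * ∑' n, eulerTerm q (y * q) n) := by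
      rw [← (hs y).tsum_sub (hs _), ((hs y).sub (hs _)).tsum_eq_zero_add, ← tsum_mul_left,
        ← tsum_neg]
      have h0 : eulerTerm q y 0 - eulerTerm q (y * q) 0 = 0 := by simp [eulerTerm]
      rw [h0, zero_add]
      refine tsum_congr fun n => ?_
      rw [eulerTerm, eulerTerm, eulerTerm, thetaCoeff_succ, qPoch_succ, mul_pow, mul_pow,
        pow_succ' q n]
      have h2 := one_sub_pow_ne_zero hq1 n
      have h3 := qPoch_self_ne_zero hq1 n
      rw [← sub_div, div_eq_iff (mul_ne_zero h3 h2)]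
      field_simp
      ring
    linear_combination h1
  have hiter : ∀ n : ℕ, ∑' m, eulerTerm q x m =
      qPoch q x n * ∑' m, eulerTerm q x m * q ^ (n * m) := by
    intro n
    simp only [← eulerTerm_mul_pow]
    induction n with
    | zero => simp [qPoch_zero]
    | succ n ih => rw [ih, hstep, qPoch_succ, pow_succ]; simp only [mul_assoc]
  have hlim := (tendsto_qPoch hq1 x).mul
    (tendsto_tsum_mul_pow hq1 (summable_norm_eulerTerm hq1 x))
  have : qPochInf q x = ∑' m, eulerTerm q x m := by
    have := tendsto_nhds_unique hlim (tendsto_const_nhds.congr hiter)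
    rw [← this]; simp [eulerTerm, thetaCoeff_zero, qPoch_zero]
  rw [this]
  exact (hs x).hasSum

lemma summable_norm_pow_div_qPoch {q : ℂ} (hq1 : ‖q‖ < 1) {x : ℂ} (hx : ‖x‖ < 1) :
    Summable fun n : ℕ => ‖x ^ n / qPoch q q n‖ := by
  obtain ⟨K, hK0, hK⟩ := exists_norm_inv_qPoch_self_le hq1
  refine Summable.of_nonneg_of_le (fun _ => norm_nonneg _) (fun n => ?_)
    ((summable_geometric_of_lt_one (norm_nonneg x) hx).mul_right K)
  rw [div_eq_mul_inv, norm_mul, norm_pow]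
  exact mul_le_mul_of_nonneg_left (hK n) (by positivity)

/-- Euler's expansion of the reciprocal of `(x;q)_∞`. -/
lemma qPochInf_mul_tsum {q : ℂ} (hq1 : ‖q‖ < 1) {x : ℂ} (hx : ‖x‖ < 1) :
    qPochInf q x * ∑' n : ℕ, x ^ n / qPoch q q n = 1 := by
  have hs : ∀ {y : ℂ}, ‖y‖ < 1 → Summable fun n : ℕ => y ^ n / qPoch q q n :=
    fun hy => (summable_norm_pow_div_qPoch hq1 hy).of_norm
  have hxq : ∀ n : ℕ, ‖x * q ^ n‖ < 1 := fun n => by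
    rw [norm_mul, norm_pow]
    exact (mul_le_of_le_one_right (norm_nonneg _) (pow_le_one₀ (norm_nonneg _) hq1.le)).trans_lt hx
  have hstep : ∀ y : ℂ, ‖y‖ < 1 → ‖y * q‖ < 1 →
      ∑' n : ℕ, (y * q) ^ n / qPoch q q n = (1 - y) * ∑' n : ℕ, y ^ n / qPoch q q n := by
    intro y hy hyq
    have h1 : ∑' n : ℕ, y ^ n / qPoch q q n - ∑' n : ℕ, (y * q) ^ n / qPoch q q n =
        y * ∑' n : ℕ, y ^ n / qPoch q q n := by
      rw [← (hs hy).tsum_sub (hs hyq), ((hs hy).sub (hs hyq)).tsum_eq_zero_add, ← tsum_mul_left]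
      simp only [pow_zero, sub_self, zero_add]
      refine tsum_congr fun n => ?_
      rw [qPoch_succ]
      have := one_sub_pow_ne_zero hq1 n
      have := qPoch_self_ne_zero hq1 n
      field_simp
      ring
    linear_combination -h1
  have hiter : ∀ n : ℕ, ∑' m : ℕ, x ^ m / qPoch q q m * q ^ (n * m) =
      qPoch q x n * ∑' m : ℕ, x ^ m / qPoch q q m := by
    intro n
    have hr : ∀ n m : ℕ, x ^ m / qPoch q q m * q ^ (n * m) = (x * q ^ n) ^ m / qPoch q q m := by
      intro n m
      rw [mul_pow, ← pow_mul]; ring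
    simp only [hr]
    induction n with
    | zero => simp [qPoch_zero]
    | succ n ih =>
      have := hxq (n + 1)
      rw [pow_succ, ← mul_assoc] at this ⊢
      rw [hstep _ (hxq n) this, ih, qPoch_succ]
      ring
  have hlim := tendsto_tsum_mul_pow hq1 (summable_norm_pow_div_qPoch hq1 hx)
  simp only [hiter] at hlim
  simpa [qPoch_zero] using tendsto_nhds_unique ((tendsto_qPoch hq1 x).mul_const _) hlim

/-- The value is `(q;q)_∞ / (q^(m+1);q)_∞`. -/
lemma hasSum_pow_div_qPoch {q : ℂ} (hq1 : ‖q‖ < 1) (m : ℕ) :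
    HasSum (fun n : ℕ => qPochInf q q * ((q ^ (m + 1)) ^ n / qPoch q q n)) (qPoch q q m) := by
  have hx : ‖q ^ (m + 1)‖ < 1 := by
    rw [norm_pow]
    exact pow_lt_one₀ (norm_nonneg _) hq1 m.succ_ne_zero
  have h := (summable_norm_pow_div_qPoch hq1 hx).of_norm.hasSum.mul_left (qPochInf q q)
  have h2 : qPochInf q q * ∑' n : ℕ, (q ^ (m + 1)) ^ n / qPoch q q n = qPoch q q m := by
    rw [qPochInf_eq_mul hq1 q m, mul_assoc, ← pow_succ', qPochInf_mul_tsum hq1 hx, mul_one]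
  rwa [h2] at h

/-! ### Expansion of `PExt` into a quadruple series, summed over `n`. -/

/-- The reciprocal of `(q;q)_{n-k}`, extended by zero to `k > n`. -/
def invQPoch (q : ℂ) (n k : ℕ) : ℂ := if k ≤ n then (qPoch q q (n - k))⁻¹ else 0

/-- The term of the quadruple series obtained by expanding all factors of `PExtTerm q a b n`,
where `c` stands for `ab/q^3`. -/
def quadTerm (q a b c : ℂ) (p : ℕ × ℕ × ℕ × ℕ) : ℂ :=
  eulerTerm q a p.2.1 * (eulerTerm q b p.2.2.1 * eulerTerm q c p.2.2.2) *
    (q ^ (p.1 * (p.2.1 + p.2.2.1 + p.2.2.2 + 1)) *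
      (qPochInf q q * invQPoch q p.1 p.2.2.2))

lemma summable_quadTerm {q : ℂ} (hq1 : ‖q‖ < 1) (a b c : ℂ) : Summable (quadTerm q a b c) := by
  obtain ⟨K, hK0, hK⟩ := exists_norm_inv_qPoch_self_le hq1
  have h3 := (summable_norm_eulerTerm hq1 a).mul_of_nonneg ((summable_norm_eulerTerm hq1 b).mul_of_nonneg
    (summable_norm_eulerTerm hq1 c) (fun _ => norm_nonneg _) fun _ => norm_nonneg _)
    (fun _ => norm_nonneg _) fun _ => mul_nonneg (norm_nonneg _) (norm_nonneg _)
  have h4 := ((summable_geometric_of_lt_one (norm_nonneg q) hq1).mul_of_nonneg h3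
    (fun _ => by positivity) fun _ => by positivity).mul_right (‖qPochInf q q‖ * K)
  refine Summable.of_norm_bounded h4 ?_
  rintro ⟨n, i, j, k⟩
  simp only [quadTerm]
  have hg : ‖invQPoch q n k‖ ≤ K := by
    rw [invQPoch]
    split_ifs
    · exact hK _
    · simpa using hK0
  -- The `+ 1`, from the factor `q^n` of the `n`-th term, supplies geometric decay in `n` uniformly
  -- in `i`, `j`, `k`.
  have hp : ‖q ^ (n * (i + j + k + 1))‖ ≤ ‖q‖ ^ n := by
    rw [norm_pow]
    exact pow_le_pow_of_le_one (norm_nonneg _) hq1.le (Nat.le_mul_of_pos_right _ (by omega))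
  rw [norm_mul, norm_mul, norm_mul, norm_mul, norm_mul (qPochInf q q)]
  calc _ ≤ ‖eulerTerm q a i‖ * (‖eulerTerm q b j‖ * ‖eulerTerm q c k‖) *
        (‖q‖ ^ n * (‖qPochInf q q‖ * K)) := by gcongr
    _ = _ := by ring

/-- The `(q;q)_n` in the Gaussian binomial completes `(q^(n+1);q)_∞` to `(q;q)_∞`. The only other
dependence on `n` is then `invQPoch`, which makes the sum over `n` an Euler series. -/
lemma hasSum_qPoch {q : ℂ} (hq1 : ‖q‖ < 1) (x : ℂ) (n : ℕ) :
    HasSum (fun k => eulerTerm q x k *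
      (qPochInf q q * invQPoch q n k))
      (qPochInf q (q * q ^ n) * qPoch q x n) := by
  have h : qPochInf q (q * q ^ n) * qPoch q x n = ∑ k ∈ Finset.range (n + 1), eulerTerm q x k *
      (qPochInf q q * invQPoch q n k) := by
    rw [qPoch_eq_sum hq1, Finset.mul_sum]
    refine Finset.sum_congr rfl fun k _ => ?_
    rw [gaussBinom, eulerTerm, invQPoch, thetaCoeff, qPochInf_eq_mul hq1 q n]
    split_ifs
    · ring
    · ring
  rw [h]
  refine hasSum_sum_of_ne_finset_zero fun k hk => ?_
  rw [invQPoch, if_neg (by simpa [Nat.lt_succ_iff] using hk)]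
  simp

lemma hasSum_mul_of_summable_norm {ι κ : Type*} {f : ι → ℂ} {g : κ → ℂ} {s t : ℂ}
    (hf : HasSum f s) (hg : HasSum g t) (hf' : Summable fun x => ‖f x‖) :
    HasSum (fun x : ι × κ => f x.1 * g x.2) (s * t) :=
  hf.mul hg (summable_mul_of_summable_norm hf' hg.summable.norm)

lemma hasSum_quadTerm_row {q : ℂ} (hq1 : ‖q‖ < 1) (a b : ℂ) (n : ℕ) :
    HasSum (fun p => quadTerm q a b (a * b / q ^ 3) (n, p)) (PExtTerm q a b n) := by
  set c := a * b / q ^ 3 with hc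
  have hk := hasSum_qPoch hq1 (c * q ^ n) n
  have hjk := hasSum_mul_of_summable_norm (hasSum_eulerTerm hq1 (b * q ^ n)) hk
    (summable_norm_eulerTerm hq1 _)
  have hijk := (hasSum_mul_of_summable_norm (hasSum_eulerTerm hq1 (a * q ^ n)) hjk
    (summable_norm_eulerTerm hq1 _)).mul_right (q ^ n)
  have h1 : PExtTerm q a b n = qPochInf q (a * q ^ n) * (qPochInf q (b * q ^ n) *
      (qPochInf q (q * q ^ n) * qPoch q (c * q ^ n) n)) * q ^ n := by
    rw [PExtTerm, hc]; ring
  rw [h1]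
  have he : (fun p => quadTerm q a b c (n, p)) = fun p : ℕ × ℕ × ℕ =>
      eulerTerm q (a * q ^ n) p.1 * (eulerTerm q (b * q ^ n) p.2.1 *
        (eulerTerm q (c * q ^ n) p.2.2 *
        (qPochInf q q * invQPoch q n p.2.2))) * q ^ n := by
    funext ⟨i, j, k⟩
    simp only [quadTerm, eulerTerm_mul_pow]
    ring
  rw [he]
  exact hijk

lemma hasSum_shifted {q : ℂ} (hq1 : ‖q‖ < 1) (m k : ℕ) :
    HasSum (fun n : ℕ => q ^ (n * (m + 1)) *
      (qPochInf q q * invQPoch q n k))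
      (q ^ (k * (m + 1)) * qPoch q q m) := by
  have h := (hasSum_pow_div_qPoch hq1 m).mul_left (q ^ (k * (m + 1)))
  rw [← (add_left_injective k).hasSum_iff]
  · have he : (fun n : ℕ => q ^ (n * (m + 1)) *
        (qPochInf q q * invQPoch q n k)) ∘ (fun n => n + k) =
        fun n => q ^ (k * (m + 1)) * (qPochInf q q * ((q ^ (m + 1)) ^ n / qPoch q q n)) := by
      funext n
      simp only [Function.comp, invQPoch, le_add_iff_nonneg_left, zero_le, if_true, Nat.add_sub_cancel]
      rw [add_mul, pow_add, ← pow_mul, mul_comm (m + 1) n]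
      ring
    rw [he]
    exact h
  · intro n hn
    rw [invQPoch, if_neg]
    · simp
    · exact fun hkn => hn ⟨n - k, Nat.sub_add_cancel hkn⟩

lemma hasSum_quadTerm_column {q : ℂ} (hq1 : ‖q‖ < 1) (a b c : ℂ) (p : ℕ × ℕ × ℕ) :
    HasSum (fun n => quadTerm q a b c (n, p))
      (eulerTerm q a p.1 * (eulerTerm q b p.2.1 * eulerTerm q c p.2.2) *
        (q ^ (p.2.2 * (p.1 + p.2.1 + p.2.2 + 1)) * qPoch q q (p.1 + p.2.1 + p.2.2))) :=
  (hasSum_shifted hq1 (p.1 + p.2.1 + p.2.2) p.2.2).mul_left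
    (eulerTerm q a p.1 * (eulerTerm q b p.2.1 * eulerTerm q c p.2.2))

lemma summable_PExtTerm {q : ℂ} (hq1 : ‖q‖ < 1) (a b : ℂ) : Summable (PExtTerm q a b) :=
  ((summable_quadTerm hq1 a b _).hasSum.prod_fiberwise (hasSum_quadTerm_row hq1 a b)).summable

lemma hasSum_PExt_triple {q : ℂ} (hq1 : ‖q‖ < 1) (a b : ℂ) :
    HasSum (fun p : ℕ × ℕ × ℕ =>
      eulerTerm q a p.1 * (eulerTerm q b p.2.1 * eulerTerm q (a * b / q ^ 3) p.2.2) *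
        (q ^ (p.2.2 * (p.1 + p.2.1 + p.2.2 + 1)) * qPoch q q (p.1 + p.2.1 + p.2.2)))
      (PExt q a b) := by
  have hs := (summable_quadTerm hq1 a b (a * b / q ^ 3)).hasSum
  have h : PExt q a b = ∑' p, quadTerm q a b (a * b / q ^ 3) p :=
    (hs.prod_fiberwise (hasSum_quadTerm_row hq1 a b)).tsum_eq
  rw [h]
  exact ((Equiv.prodComm _ _).hasSum_iff.mpr hs).prod_fiberwise
    (hasSum_quadTerm_column hq1 a b _)

/-! ### Collecting powers of `a` and `b`; reduction of `PExt` to `Omega`. -/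

lemma thetaCoeff_sq (q : ℂ) (k : ℕ) : thetaCoeff q k ^ 2 * q ^ k = q ^ (k * k) := by
  induction k with
  | zero => simp [thetaCoeff_zero]
  | succ k ih =>
    rw [thetaCoeff_succ, show (k + 1) * (k + 1) = k * k + (k + (k + 1)) by ring,
      pow_add q (k * k), ← ih]
    ring

/-- The triple series of `P(a,b)` with the powers of `a` and `b` collected. -/
def collectedTerm (q a b : ℂ) (p : (ℕ × ℕ) × ℕ) : ℂ :=
  thetaCoeff q p.1.1 * thetaCoeff q p.1.2 * a ^ p.1.1 * b ^ p.1.2 *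
    ((-1) ^ p.2 * q ^ p.2.choose 2 * q⁻¹ ^ p.2 * gaussTrinom q p.1.1 p.1.2 p.2)

/-- Reindex by `A = i + k`, `B = j + k`. Of the factor `q^(k^2+k)`, `thetaCoeff_sq` absorbs
`q^(k^2)` at the cost of another `q^k`; against the `q^(-3k)` in `c^k` this leaves `q^(-k)`, hence
the argument `q⁻¹` of `trinomSum`. -/
lemma hasSum_collectedTerm {q : ℂ} (hq0 : q ≠ 0) (hq1 : ‖q‖ < 1) (a b : ℂ) :
    HasSum (collectedTerm q a b) (PExt q a b) := by
  let φ : ℕ × ℕ × ℕ → (ℕ × ℕ) × ℕ := fun p => ((p.2.2 + p.1, p.2.2 + p.2.1), p.2.2)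
  have hφ : Function.Injective φ := by
    rintro ⟨i, j, k⟩ ⟨i', j', k'⟩ h
    simp only [φ, Prod.mk.injEq] at h ⊢
    omega
  rw [← hφ.hasSum_iff]
  · have he : collectedTerm q a b ∘ φ = fun p : ℕ × ℕ × ℕ =>
        eulerTerm q a p.1 * (eulerTerm q b p.2.1 * eulerTerm q (a * b / q ^ 3) p.2.2) *
        (q ^ (p.2.2 * (p.1 + p.2.1 + p.2.2 + 1)) * qPoch q q (p.1 + p.2.1 + p.2.2)) := by
      funext ⟨i, j, k⟩
      simp only [Function.comp, φ, collectedTerm, gaussTrinom_add, thetaCoeff_add]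
      rw [← thetaCoeff, show k * (i + j + k + 1) = k * k + (k * i + k * j + k) by ring,
        pow_add q (k * k), ← thetaCoeff_sq, eulerTerm, eulerTerm, eulerTerm, div_pow, ← pow_mul,
        show 3 * k = k + k + k by ring, show i + j + k = k + i + j by ring]
      have := qPoch_self_ne_zero hq1 i
      have := qPoch_self_ne_zero hq1 j
      have := qPoch_self_ne_zero hq1 k
      rw [inv_pow, mul_pow, pow_add, pow_add, pow_add, pow_add]
      have := pow_ne_zero k hq0
      rw [pow_add, pow_add]
      generalize q ^ k = u at *
      generalize q ^ (k * i) = v at *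
      generalize q ^ (k * j) = w at *
      field_simp
    rw [he]
    exact hasSum_PExt_triple hq1 a b
  · rintro ⟨⟨A, B⟩, k⟩ hp
    have : ¬(k ≤ A ∧ k ≤ B) := fun h => hp ⟨(A - k, B - k, k), by simp [φ, h.1, h.2]⟩
    simp [collectedTerm, gaussTrinom_of_not q this]

lemma hasSum_collectedTerm_fiber (q a b : ℂ) (p : ℕ × ℕ) :
    HasSum (fun k => collectedTerm q a b (p, k))
      (thetaCoeff q p.1 * thetaCoeff q p.2 * a ^ p.1 * b ^ p.2 * trinomSum q q⁻¹ p.1 p.2) := by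
  have h : HasSum (fun k => (-1) ^ k * q ^ k.choose 2 * q⁻¹ ^ k * gaussTrinom q p.1 p.2 k)
      (trinomSum q q⁻¹ p.1 p.2) := by
    refine hasSum_sum_of_ne_finset_zero fun k hk => ?_
    rw [gaussTrinom_of_not q fun h => hk (by simpa [Nat.lt_succ_iff] using h.1), mul_zero]
  exact h.mul_left (thetaCoeff q p.1 * thetaCoeff q p.2 * a ^ p.1 * b ^ p.2)

lemma PExt_eq {q : ℂ} (hq0 : q ≠ 0) (hq1 : ‖q‖ < 1) (a b : ℂ) :
    PExt q a b = Omega q a b + (Omega q a b - Omega q (a / q) b - Omega q a (b / q) +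
      Omega q (a / q) (b / q)) / (q - 1) := by
  have h1 := (hasSum_collectedTerm hq0 hq1 a b).prod_fiberwise
    (g := fun p => thetaCoeff q p.1 * thetaCoeff q p.2 * a ^ p.1 * b ^ p.2 *
      trinomSum q q⁻¹ p.1 p.2) (hasSum_collectedTerm_fiber q a b)
  have h2 := (hasSum_omegaTerm hq1 a b).add ((((hasSum_omegaTerm hq1 a b).sub
    (hasSum_omegaTerm hq1 (a / q) b)).sub (hasSum_omegaTerm hq1 a (b / q))).add
    (hasSum_omegaTerm hq1 (a / q) (b / q)) |>.div_const (q - 1))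
  have he : (fun p : ℕ × ℕ => thetaCoeff q p.1 * thetaCoeff q p.2 * a ^ p.1 * b ^ p.2 *
      trinomSum q q⁻¹ p.1 p.2) = fun p => omegaTerm q a b p + (omegaTerm q a b p -
        omegaTerm q (a / q) b p - omegaTerm q a (b / q) p + omegaTerm q (a / q) (b / q) p) /
        (q - 1) := by
    funext p
    simp only [omegaTerm, thetaCoeff_add, trinomSum_inv hq0 hq1, div_pow]
    ring
  rw [he] at h1
  exact h1.unique h2

/-! ### Elimination by the functional equations. -/

lemma PExt_identity {q a b : ℂ} (hq0 : q ≠ 0) (hq1 : ‖q‖ < 1) (hab : a + b ≠ 0) :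
    q ^ 2 / (1 + q) * Omega q (a / q) (b / q)
        - a * b * (a + b - q - q ^ 2) / ((1 + q) * (a + b)) * Omega q a b
        - a ^ 2 * b ^ 2 / (q * (a + b)) * Omega q (a * q) (b * q)
        - (a * q ^ 2 + b * q ^ 2 - a * b - a * b * q) / ((1 + q) * (a + b))
      = (a - b * q) * (b - a * q) / ((1 + q) * (a + b)) * PExt q a b := by
  have hm : q - 1 ≠ 0 := by
    rw [sub_ne_zero]; rintro rfl; simp at hq1
  have hp : 1 + q ≠ 0 := by
    intro h
    rw [← neg_eq_of_add_eq_zero_right h] at hq1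
    simp at hq1
  have e1 := Omega_functional hq1 a b
  have e2 := Omega_functional hq1 b a
  rw [Omega_symm hq1 b a, Omega_symm hq1 (b * q)] at e2
  have e3 := theta_functional hq1 (a / q)
  have e4 := theta_functional hq1 (b / q)
  have e5 := Omega_functional hq1 (a / q) (b / q)
  have e6 := sub_mul_Omega hq1 (a / q) b
  have e7 := sub_mul_Omega hq1 a (b / q)
  simp only [div_mul_cancel₀ _ hq0] at e3 e4 e5
  rw [PExt_eq hq0 hq1]
  generalize Omega q (a / q) b = X at *
  generalize Omega q a (b / q) = Y at *
  generalize Omega q (a / q) (b / q) = Z at *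
  generalize Omega q (a * q) (b * q) = V at *
  generalize Omega q a b = W at *
  -- `W` and `V` serve as the independent unknowns; every other theta or `Omega` value is rewritten
  -- in them.
  have t1 : theta q a = W + b * V := by linear_combination -e1
  have t2 : theta q b = W + a * V := by linear_combination -e2
  rw [t1] at e3 e7
  rw [t2] at e4 e6
  rw [e3] at e5 e6
  rw [e4] at e7
  subst e5
  -- The equations for `X` and `Y` stay multiplied out, so the cases `a = bq` and `b = aq` need no
  -- separate treatment.
  have hX : (a - b * q) * X = a * (1 - a / q * (W + b * V)) - b * q * (W + a * V) := by
    field_simp at e6 ⊢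
    linear_combination e6
  have hY : (b - a * q) * Y = b * (1 - b / q * (W + a * V)) - a * q * (W + b * V) := by
    field_simp at e7 ⊢
    linear_combination -e7
  have key : (a - b * q) * (b - a * q) * (W + (W - X - Y +
      (1 - a / q * (W + b * V) - b / q * W)) / (q - 1)) =
      (a - b * q) * (b - a * q) * (W + (W + (1 - a / q * (W + b * V) - b / q * W)) / (q - 1)) -
      ((b - a * q) * (a * (1 - a / q * (W + b * V)) - b * q * (W + a * V)) +
        (a - b * q) * (b * (1 - b / q * (W + a * V)) - a * q * (W + b * V))) / (q - 1) := by
    rw [← hX, ← hY]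
    ring
  rw [div_mul_eq_mul_div ((a - b * q) * (b - a * q)), key]
  clear key hX hY e1 e2 e3 e4 e6 e7 t1 t2
  field_simp
  ring

/-! ### Comparison of `P` with its cancelled form. -/

lemma qPochInf_mul_PTerm {q a b : ℂ} (hq1 : ‖q‖ < 1)
    (ha : ∀ k : ℕ, 1 - a * q ^ k ≠ 0) (hb : ∀ k : ℕ, 1 - b * q ^ k ≠ 0)
    (hc : ∀ k : ℕ, 1 - a * b / q ^ 3 * q ^ k ≠ 0) (n : ℕ) :
    qPochInf q q * qPochInf q a * qPochInf q b * PTerm q a b n = PExtTerm q a b n := by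
  have h : ∀ x : ℂ, (∀ k : ℕ, 1 - x * q ^ k ≠ 0) → qPoch q x n ≠ 0 :=
    fun x hx => Finset.prod_ne_zero_iff.mpr fun i _ => hx i
  have := h a ha
  have := h b hb
  have h3 := h _ hc
  have := qPoch_self_ne_zero hq1 n
  rw [PTerm, PExtTerm, qPochInf_eq_mul hq1 q n, qPochInf_eq_mul hq1 a n, qPochInf_eq_mul hq1 b n,
    two_mul, qPoch_add]
  generalize qPoch q (a * b / q ^ 3) n = u at *
  generalize qPoch q (a * b / q ^ 3 * q ^ n) n = v at *
  field_simp

end PartialTheta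

end

theorem mainTheorem7 (q a b : ℂ) (hq0 : q ≠ 0) (hq1 : ‖q‖ < 1) (hab : a + b ≠ 0) :
    -- all products and series that occur converge
    (∀ x : ℂ, Multipliable fun i : ℕ => 1 - x * q ^ i) ∧
    (∀ x : ℂ, Summable fun n : ℕ => (-1) ^ n * q ^ n.choose 2 * x ^ n) ∧
    (∀ x y : ℂ, Summable fun n : ℕ =>
      (-1) ^ n * q ^ n.choose 2 * y ^ n * PartialTheta.theta q (x * q ^ n)) ∧
    -- the identity, when no denominator in the series for `P(a,b)` vanishes
    ((∀ k : ℕ, 1 - a * q ^ k ≠ 0) → (∀ k : ℕ, 1 - b * q ^ k ≠ 0) →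
      (∀ k : ℕ, 1 - a * b / q ^ 3 * q ^ k ≠ 0) →
      Summable (PartialTheta.PTerm q a b) ∧
      q ^ 2 / (1 + q) * PartialTheta.Omega q (a / q) (b / q)
        - a * b * (a + b - q - q ^ 2) / ((1 + q) * (a + b)) * PartialTheta.Omega q a b
        - a ^ 2 * b ^ 2 / (q * (a + b)) * PartialTheta.Omega q (a * q) (b * q)
        - (a * q ^ 2 + b * q ^ 2 - a * b - a * b * q) / ((1 + q) * (a + b))
      = (a - b * q) * (b - a * q) / ((1 + q) * (a + b)) * PartialTheta.P q a b) ∧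
    -- the identity without that restriction, common factors in `P(a,b)` being cancelled
    (Summable (PartialTheta.PExtTerm q a b) ∧
      q ^ 2 / (1 + q) * PartialTheta.Omega q (a / q) (b / q)
        - a * b * (a + b - q - q ^ 2) / ((1 + q) * (a + b)) * PartialTheta.Omega q a b
        - a ^ 2 * b ^ 2 / (q * (a + b)) * PartialTheta.Omega q (a * q) (b * q)
        - (a * q ^ 2 + b * q ^ 2 - a * b - a * b * q) / ((1 + q) * (a + b))
      = (a - b * q) * (b - a * q) / ((1 + q) * (a + b)) * PartialTheta.PExt q a b) := by
  have hP (ha : ∀ k : ℕ, 1 - a * q ^ k ≠ 0) (hb : ∀ k : ℕ, 1 - b * q ^ k ≠ 0)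
      (hc : ∀ k : ℕ, 1 - a * b / q ^ 3 * q ^ k ≠ 0) :
      Summable (PartialTheta.PTerm q a b) ∧ PartialTheta.P q a b = PartialTheta.PExt q a b := by
    have hterm := PartialTheta.qPochInf_mul_PTerm hq1 ha hb hc
    constructor
    -- The prefactor `(q,a,b;q)_∞` is nonzero here, so summability passes back from `PExtTerm` to
    -- `PTerm`.
    · have hne := mul_ne_zero (mul_ne_zero
        (PartialTheta.qPochInf_ne_zero hq1 (PartialTheta.one_sub_pow_ne_zero hq1))
        (PartialTheta.qPochInf_ne_zero hq1 ha)) (PartialTheta.qPochInf_ne_zero hq1 hb)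
      rw [← summable_mul_left_iff hne]
      exact (PartialTheta.summable_PExtTerm hq1 a b).congr fun n => (hterm n).symm
    · rw [PartialTheta.P, PartialTheta.PExt, ← tsum_mul_left]
      exact tsum_congr hterm
  have hid := PartialTheta.PExt_identity hq0 hq1 hab
  refine ⟨PartialTheta.multipliable_one_sub hq1, PartialTheta.summable_thetaCoeff hq1,
    PartialTheta.summable_Omega hq1, fun ha hb hc => ⟨(hP ha hb hc).1, ?_⟩,
    PartialTheta.summable_PExtTerm hq1 a b, hid⟩
  rw [(hP ha hb hc).2]
  exact hid
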